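/- All graphs and digraphs are finite. For a digraph $\vec H$, let $H$ be its underlying undirected simple graph (distinct $u,v$ are adjacent in $H$ if and only if $\overrightarrow{uv}$ or $\overrightarrow{vu}$ is an arc of $\vec H$), and let $\Delta^-(\vec H)$ be its maximum indegree. For digraphs $\vec H_1,\vec H_2$, let $\vec H_1 \oslash \vec H_2$ be the underlying undirected graph of the digraph with vertex set $V(H_1)\times V(H_2)$ in which there is an arc from $(x,y)$ to $(x',y')$ if and only if $x=x'$ and $\overrightarrow{yy'}\in E(\vec H_2)$, or $y=y'$ and $\overrightarrow{xx'}\in E(\vec H_1)$, or $\overrightarrow{xx'}\in E(\vec H_1)$ and $\overrightarrow{yy'}\in E(\vec H_2)$. A graph is contained in another if it is isomorphic to a (not necessarily induced) subgraph of it, and $\operatorname{tw}$ denotes treewidth. **Theorem 1.7.** For any integers $s,t,k\ge 1$, there is a graph $G$ with $\operatorname{tw}(G)=k$ such that, for any digraphs $\vec H_1$ and $\vec H_2$ with $\Delta^-(\vec H_1)\le s$, $\Delta^-(\vec H_2)\le t$ and $\operatorname{tw}(H_1),\operatorname{tw}(H_2)\le k-1$, the graph $G$ is not contained in $\vec H_1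 \oslash \vec H_2$. -/

import Mathlib

namespace SimpleGraph

/-- A `T`-decomposition of a graph `G`, indexed by the nodes of a tree `T`.
In Mathlib, `IsTree` and `Connected` both include non-emptiness. -/
structure TreeDecomposition {V : Type*} (G : SimpleGraph V) {ι : Type*} (T : SimpleGraph ι) where
  /-- The indexing graph is a (non-null) tree. -/
  isTree : T.IsTree
  /-- The bag of each node. -/
  bag : ι → Finset V
  /-- Both ends of every edge lie in a common bag. -/
  exists_bag_of_adj : ∀ v w : V, G.Adj v w → ∃ x : ι, v ∈ bag x ∧ w ∈ bag x
  /-- The nodes whose bags contain a given vertex induce a non-empty connected subtree. -/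
  connected : ∀ v : V, (T.induce {x : ι | v ∈ bag x}).Connected

/-- The width of a tree-decomposition: the maximum size of a bag, minus one
(an integer, so that the subtraction is not truncated). -/
def TreeDecomposition.width {V : Type*} {G : SimpleGraph V} {ι : Type*} [Fintype ι]
    {T : SimpleGraph ι} (D : G.TreeDecomposition T) : ℤ :=
  ((Finset.univ.sup fun x : ι => (D.bag x).card : ℕ) : ℤ) - 1

/-- The treewidth of a finite graph: the minimum width of a tree-decomposition. -/
noncomputable def treewidth {V : Type*} (G : SimpleGraph V) : ℤ :=
  sInf {w : ℤ | ∃ (ι : Type) (_ : Fintype ι) (T : SimpleGraph ι) (D : G.TreeDecomposition T),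
    D.width = w}

end SimpleGraph

namespace Digraph

/-- The indegree of a vertex `v`: the number of vertices with an arc to `v`. -/
noncomputable def indegree {V : Type*} [Fintype V] (H : Digraph V) (v : V) : ℕ :=
  {u : V | H.Adj u v}.ncard

/-- The maximum indegree of a finite digraph. -/
noncomputable def maxIndegree {V : Type*} [Fintype V] (H : Digraph V) : ℕ :=
  Finset.univ.sup fun v : V => H.indegree v

/-- The directed product of two digraphs (as a digraph). -/
def directedProd {V W : Type*} (H₁ : Digraph V) (H₂ : Digraph W) : Digraph (V × W) where
  Adj a b := (a.1 = b.1 ∧ H₂.Adj a.2 b.2) ∨ (a.2 = b.2 ∧ H₁.Adj a.1 b.1) ∨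
    (H₁.Adj a.1 b.1 ∧ H₂.Adj a.2 b.2)

/-- The underlying undirected graph of a digraph: `u` and `v` are adjacent when they are distinct
and there is an arc between them in at least one direction. -/
abbrev underlying {V : Type*} (H : Digraph V) : SimpleGraph V :=
  H.toSimpleGraphInclusive

end Digraph

/-! The graph is a tree of bags of at most `k + 1` mutually adjacent vertices: from each bag, any
position can be refilled by any of `N` new vertices. A copy in the product turns each bag into a
pair of tuples `p`, `q`. Cliques in the two factors have at most `k` vertices, so both tuples always
have repeated entries. Indegrees are bounded and `N` is large, so some refill receives arcs from all
the other entries and, in one coordinate, is new and sends no arc back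
(`exists_dominates_of_forall_adj`).

`IsExtendable` keeps only the resulting game, in which the total number of distinct entries of `p`
and `q` can be pushed past its bound `2 * k`. Refilling a position repeated in both tuples raises
the total (`false_of_isRepeated_of_isRepeated`); `false_of_isBeyond` either reaches such a position
or raises the total on the way. -/

open Finset Function

namespace SimpleGraph

/-! ### Trees given by parent maps -/

section ParentTree

variable {ι : Type*} (par : ι → ι)

/-- The graph joining each node to its parent. -/
def parentGraph : SimpleGraph ι := fromRel fun x y => par x = y

variable {par}

theorem induce_parentGraph_connected {rank : ι → ℕ} {S : Set ι} {t : ι} (ht : t ∈ S)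
    (h : ∀ x ∈ S, x ≠ t → rank (par x) < rank x ∧ par x ∈ S) :
    ((parentGraph par).induce S).Connected := by
  have key : ∀ n, ∀ x : S, rank x = n →
      ((parentGraph par).induce S).Reachable x ⟨t, ht⟩ := by
    intro n
    induction n using Nat.strong_induction_on with
    | _ n ih =>
      intro x hx
      by_cases hxt : x.1 = t
      · have : x = ⟨t, ht⟩ := Subtype.ext hxt
        rw [this]
      · obtain ⟨h1, h2⟩ := h x x.2 hxt
        refine Reachable.trans (Adj.reachable ?_) (ih _ (hx ▸ h1) ⟨par x, h2⟩ rfl)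
        simp only [comap_adj, Embedding.subtype_apply, parentGraph, fromRel_adj]
        refine ⟨fun he => ?_, by simp⟩
        rw [← he] at h1
        exact lt_irrefl _ h1
  have : Nonempty S := ⟨⟨t, ht⟩⟩
  exact ⟨fun x y => (key _ x rfl).trans (key _ y rfl).symm⟩

theorem parentGraph_isTree [Finite ι] {rank : ι → ℕ} (r : ι)
    (h : ∀ x, x ≠ r → rank (par x) < rank x) (hr : par r = r) :
    (parentGraph par).IsTree := by
  classical
  have := Fintype.ofFinite ι
  have hc : (parentGraph par).Connected :=
    (induceUnivIso _).connected_iff.1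
      (induce_parentGraph_connected (Set.mem_univ r) fun x _ hx => ⟨h x hx, Set.mem_univ _⟩)
  refine isTree_iff_connected_and_card.2 ⟨hc, le_antisymm ?_ hc.card_vert_le_card_edgeSet_add_one⟩
  have hsub : (parentGraph par).edgeFinset ⊆ (univ.erase r).image fun x => s(x, par x) := by
    intro e he
    rw [mem_edgeFinset] at he
    induction e with
    | _ x y =>
      revert he
      simp only [mem_edgeSet, parentGraph, fromRel_adj, Finset.mem_image, mem_erase,
        Finset.mem_univ, and_true]
      rintro ⟨hne, rfl | rfl⟩
      · exact ⟨x, fun hx => hne (by rw [hx, hr]), rfl⟩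
      · exact ⟨y, fun hy => hne (by rw [hy, hr]), Sym2.eq_swap⟩
  have hcard := (card_le_card hsub).trans card_image_le
  rw [card_erase_of_mem (Finset.mem_univ r), card_univ] at hcard
  have hpos : 0 < Fintype.card ι := Fintype.card_pos_iff.2 ⟨r⟩
  rw [Nat.card_eq_fintype_card, Nat.card_eq_fintype_card, ← edgeFinset_card]
  omega

end ParentTree

/-! ### Cliques and treewidth -/

section Clique

variable {V ι : Type*} {G : SimpleGraph V} {T : SimpleGraph ι}

theorem TreeDecomposition.exists_adj_reachable (D : G.TreeDecomposition T) {x : ι} {v : V}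
    (hv : v ∉ D.bag x) :
    ∃ y, T.Adj x y ∧ ∀ z, v ∈ D.bag z → (T.deleteEdges {s(x, y)}).Reachable y z := by
  obtain ⟨z₀, hz₀⟩ := (D.connected v).nonempty
  obtain ⟨p, hp⟩ := (D.isTree.connected x z₀).exists_isPath
  cases p with
  | nil => exact absurd hz₀ hv
  | @cons _ y _ hxy q =>
    rw [Walk.cons_isPath_iff] at hp
    refine ⟨y, hxy, fun z hz => ?_⟩
    have hq : s(x, y) ∉ q.edges := fun h => hp.2 (q.fst_mem_support_of_mem_edges h)
    refine Reachable.trans ⟨q.toDeleteEdge _ hq⟩ ?_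
    let φ : T.induce {x : ι | v ∈ D.bag x} →g T.deleteEdges {s(x, y)} :=
      { toFun := Subtype.val
        map_rel' := by
          rintro ⟨a, ha⟩ ⟨b, hb⟩ hab
          rw [deleteEdges_adj]
          refine ⟨hab, fun h => ?_⟩
          rcases Sym2.eq_iff.1 (Set.mem_singleton_iff.1 h) with ⟨h1, -⟩ | ⟨-, h1⟩
          · exact hv (h1 ▸ ha)
          · exact hv (h1 ▸ hb) }
    exact ((D.connected v).preconnected ⟨z₀, hz₀⟩ ⟨z, hz⟩).map φ

/-- Every clique is contained in a bag. -/
theorem TreeDecomposition.exists_bag_of_isClique [Fintype ι] (D : G.TreeDecomposition T)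
    {K : Set V} (hK : G.IsClique K) : ∃ x, ∀ v ∈ K, v ∈ D.bag x := by
  classical
  by_contra! h
  choose g hgK hg using h
  -- Each node `x` points along an edge towards the subtree of a clique vertex missing from its bag.
  -- There are fewer edges than nodes, so two nodes point at each other, and the two subtrees lie on
  -- opposite sides of a bridge, yet they meet.
  choose f hf hreach using fun x => D.exists_adj_reachable (hg x)
  have hcard := D.isTree.card_edgeFinset
  have hlt : #T.edgeFinset < #(univ : Finset ι) := by
    rw [card_univ]; omega
  obtain ⟨x, -, y, -, hne, he⟩ := exists_ne_map_eq_of_card_lt_of_maps_to hlt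
    (f := fun x => s(x, f x)) (fun x _ => by simpa using hf x)
  obtain ⟨h1, -⟩ | ⟨h1, h2⟩ := Sym2.eq_iff.1 he
  · exact hne h1
  · obtain ⟨z, hz1, hz2⟩ : ∃ z, g x ∈ D.bag z ∧ g y ∈ D.bag z := by
      by_cases hxy : g x = g y
      · obtain ⟨z, hz⟩ := (D.connected (g x)).nonempty
        exact ⟨z, hz, hxy ▸ hz⟩
      · exact D.exists_bag_of_adj _ _ (hK (hgK x) (hgK y) hxy)
    have hx := hreach x z hz1
    have hy := hreach y z hz2
    rw [← he, ← h1] at hy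
    rw [h2] at hx
    have hb := isAcyclic_iff_forall_adj_isBridge.1 D.isTree.isAcyclic (hf x)
    rw [isBridge_iff] at hb
    rw [h2] at hb hy
    exact hb (hy.trans hx.symm)

theorem TreeDecomposition.card_le_of_isClique [Fintype ι] (D : G.TreeDecomposition T)
    {K : Finset V} (hK : G.IsClique (K : Set V)) : (#K : ℤ) ≤ D.width + 1 := by
  obtain ⟨x, hx⟩ := D.exists_bag_of_isClique hK
  have h1 : #K ≤ #(D.bag x) := card_le_card fun v hv => hx v hv
  have h2 := le_sup (f := fun x : ι => #(D.bag x)) (Finset.mem_univ x)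
  simp only [TreeDecomposition.width]
  have := h1.trans h2
  omega

variable (G)

theorem bddBelow_width : BddBelow {w : ℤ | ∃ (ι : Type) (_ : Fintype ι) (T : SimpleGraph ι)
    (D : G.TreeDecomposition T), D.width = w} := by
  refine ⟨-1, ?_⟩
  rintro w ⟨ι, _, T, D, rfl⟩
  simp only [TreeDecomposition.width]
  omega

theorem exists_treeDecomposition_width_eq [Fintype V] :
    ∃ (ι : Type) (_ : Fintype ι) (T : SimpleGraph ι) (D : G.TreeDecomposition T),
      D.width = G.treewidth := by
  refine Int.csInf_mem ?_ (bddBelow_width G)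
  refine ⟨_, Unit, inferInstance, ⊥, ⟨.of_subsingleton, fun _ => univ, by simp, fun v => ?_⟩, rfl⟩
  have : Nonempty {x : Unit | v ∈ (univ : Finset V)} := ⟨⟨(), by simp⟩⟩
  exact ⟨fun x y => by rw [Subsingleton.elim x y]⟩

variable {G}

theorem card_le_treewidth_of_isClique [Fintype V] {K : Finset V}
    (hK : G.IsClique (K : Set V)) : (#K : ℤ) ≤ G.treewidth + 1 := by
  obtain ⟨ι, _, T, D, hD⟩ := G.exists_treeDecomposition_width_eq
  exact hD ▸ D.card_le_of_isClique hK

theorem TreeDecomposition.treewidth_le {ι : Type} {T : SimpleGraph ι} [Fintype ι]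
    (D : G.TreeDecomposition T) : G.treewidth ≤ D.width :=
  csInf_le (bddBelow_width G) ⟨ι, inferInstance, T, D, rfl⟩

end Clique

end SimpleGraph

/-! ### The refilling game on pairs of tuples -/

section Tuples

variable {α W W₁ W₂ : Type*}

/-- The entry of `p` at `j` is repeated elsewhere. -/
def IsRepeated (p : α → W) (j : α) : Prop := ∃ i, i ≠ j ∧ p i = p j

/-- `a` dominates all entries of `p` other than the one at `j`. -/
def Dominates (H : Digraph W) (p : α → W) (j : α) (a : W) : Prop :=
  ∀ i, i ≠ j → p i = a ∨ H.Adj (p i) a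

/-- `a` is neither equal to nor has an arc to an entry of `p` other than the one at `j`. -/
def IsBeyond (H : Digraph W) (p : α → W) (j : α) (a : W) : Prop :=
  ∀ i, i ≠ j → p i ≠ a ∧ ¬ H.Adj a (p i)

/-- The number of distinct entries of a tuple. -/
noncomputable def numValues (p : α → W) : ℕ := (Set.range p).ncard

variable [DecidableEq α] {p : α → W} {j : α} {a : W}

theorem range_update_eq (p : α → W) (j : α) (a : W) :
    Set.range (update p j a) = insert a (p '' {j}ᶜ) := by
  ext x
  constructor
  · rintro ⟨i, rfl⟩
    by_cases h : i = j
    · subst h; simp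
    · rw [update_of_ne h]; exact Or.inr ⟨i, h, rfl⟩
  · rintro (rfl | ⟨i, hi, rfl⟩)
    · exact ⟨j, update_self ..⟩
    · exact ⟨i, update_of_ne hi ..⟩

theorem numValues_update_of_eq {i : α} (hi : i ≠ j) (h : p i = a) :
    numValues (update p j a) = (p '' {j}ᶜ).ncard := by
  rw [numValues, range_update_eq, Set.insert_eq_of_mem]
  exact ⟨i, hi, h⟩

theorem IsRepeated.numValues_eq (h : IsRepeated p j) : numValues p = (p '' {j}ᶜ).ncard := by
  obtain ⟨i, hi, h⟩ := h
  simpa using numValues_update_of_eq hi h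

theorem isRepeated_update_self {i : α} (hi : i ≠ j) (h : p i = a) :
    IsRepeated (update p j a) j :=
  ⟨i, hi, by rw [update_self, update_of_ne hi, h]⟩

/-- Any entry of the pair of tuples can be replaced by one dominating all other entries and beyond
them in one of the coordinates, in such a way that this can be repeated `n` times. Throughout, each
tuple has at most `k` distinct entries. -/
def IsExtendable (H₁ : Digraph W₁) (H₂ : Digraph W₂) (k : ℕ) :
    ℕ → (α → W₁) → (α → W₂) → Prop
  | 0, p, q => numValues p ≤ k ∧ numValues q ≤ k
  | n + 1, p, q => (numValues p ≤ k ∧ numValues q ≤ k) ∧ ∀ j, ∃ a b,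
      IsExtendable H₁ H₂ k n (update p j a) (update q j b) ∧
      Dominates H₁ p j a ∧ Dominates H₂ q j b ∧ (IsBeyond H₁ p j a ∨ IsBeyond H₂ q j b)

namespace IsExtendable

variable {H₁ : Digraph W₁} {H₂ : Digraph W₂} {k n m : ℕ} {p : α → W₁} {q : α → W₂}

theorem numValues_le (h : IsExtendable H₁ H₂ k n p q) : numValues p ≤ k ∧ numValues q ≤ k := by
  cases n with
  | zero => exact h
  | succ n => exact h.1

theorem mono (hmn : m ≤ n) (h : IsExtendable H₁ H₂ k n p q) : IsExtendable H₁ H₂ k m p q := by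
  induction m generalizing n p q with
  | zero => exact h.numValues_le
  | succ m ih =>
    obtain ⟨n, rfl⟩ : ∃ l, n = l + 1 := ⟨n - 1, by omega⟩
    refine ⟨h.1, fun j => ?_⟩
    obtain ⟨a, b, hab, h'⟩ := h.2 j
    exact ⟨a, b, ih (by omega) hab, h'⟩

theorem swap (h : IsExtendable H₁ H₂ k n p q) : IsExtendable H₂ H₁ k n q p := by
  induction n generalizing p q with
  | zero => exact h.symm
  | succ n ih =>
    refine ⟨h.1.symm, fun j => ?_⟩
    obtain ⟨a, b, hab, h1, h2, h3⟩ := h.2 j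
    exact ⟨b, a, ih hab, h2, h1, h3.symm⟩

end IsExtendable

variable [Fintype α]

theorem numValues_update_of_forall_ne (h : ∀ i, i ≠ j → p i ≠ a) :
    numValues (update p j a) = (p '' {j}ᶜ).ncard + 1 := by
  rw [numValues, range_update_eq, Set.ncard_insert_of_notMem _ (Set.toFinite _)]
  rintro ⟨i, hi, rfl⟩
  exact h i hi rfl

theorem numValues_eq_of_not_isRepeated (h : ¬ IsRepeated p j) :
    numValues p = (p '' {j}ᶜ).ncard + 1 := by
  simpa using numValues_update_of_forall_ne (p := p) (a := p j) fun i hi he => h ⟨i, hi, he⟩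

theorem exists_isRepeated (h : numValues p < Fintype.card α) : ∃ j, IsRepeated p j := by
  by_contra! hp
  have hinj : Injective p := fun i j hij => by
    by_contra hne
    exact hp j ⟨i, hne, hij⟩
  rw [numValues, ← Set.image_univ, Set.ncard_image_of_injective _ hinj, Set.ncard_univ,
    Nat.card_eq_fintype_card] at h
  exact lt_irrefl _ h

namespace IsExtendable

variable {H₁ : Digraph W₁} {H₂ : Digraph W₂} {k L F : ℕ} {p : α → W₁} {q : α → W₂}

/-- Vacating a doubly repeated position loses no value in either tuple, and the refill is new in at
least one of them. -/
theorem false_of_isRepeated_of_isRepeated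
    (IH : ∀ (p : α → W₁) (q : α → W₂), F + 1 ≤ numValues p + numValues q →
      ¬ IsExtendable H₁ H₂ k L p q)
    (hF : F ≤ numValues p + numValues q) {j : α} (hp : IsRepeated p j) (hq : IsRepeated q j)
    (h : IsExtendable H₁ H₂ k (L + 1) p q) : False := by
  obtain ⟨a, b, hab, -, -, hbey⟩ := h.2 j
  refine IH _ _ ?_ hab
  rw [hp.numValues_eq, hq.numValues_eq] at hF
  have hp' : (p '' {j}ᶜ).ncard ≤ numValues (update p j a) := by
    rw [numValues, range_update_eq]
    exact Set.ncard_le_ncard (Set.subset_insert _ _) (Set.toFinite _)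
  have hq' : (q '' {j}ᶜ).ncard ≤ numValues (update q j b) := by
    rw [numValues, range_update_eq]
    exact Set.ncard_le_ncard (Set.subset_insert _ _) (Set.toFinite _)
  rcases hbey with h | h
  · rw [numValues_update_of_forall_ne fun i hi => (h i hi).1]
    omega
  · rw [numValues_update_of_forall_ne (p := q) fun i hi => (h i hi).1]
    omega

/-- The position `w` is repeated in `q`, and `p w` sends no arc to the rest of `p`. Refill a
position repeated in `p`: unless the total rises, either `p` gains a value and the situation recurs,
which happens at most `c` times, or `w` becomes repeated in both tuples. -/
theorem false_of_isBeyond (hk : k < Fintype.card α)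
    (IH : ∀ (p : α → W₁) (q : α → W₂), F + 1 ≤ numValues p + numValues q →
      ¬ IsExtendable H₁ H₂ k L p q)
    (c : ℕ) {p : α → W₁} {q : α → W₂} (hc : k + 1 ≤ numValues p + c)
    (hF : F ≤ numValues p + numValues q) {w : α} (hp : IsBeyond H₁ p w (p w))
    (hq : IsRepeated q w) (h : IsExtendable H₁ H₂ k (L + 1 + c) p q) : False := by
  induction c generalizing p q w with
  | zero => have := h.numValues_le.1; omega
  | succ c ih =>
    obtain ⟨j, hj⟩ := exists_isRepeated (h.numValues_le.1.trans_lt hk)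
    by_cases hqj : IsRepeated q j
    · exact false_of_isRepeated_of_isRepeated IH hF hj hqj (h.mono (by omega))
    have hwj : w ≠ j := by rintro rfl; exact hqj hq
    have hpn := hj.numValues_eq
    have hqn := numValues_eq_of_not_isRepeated hqj
    obtain ⟨a, b, hab, hdom, -, hbey⟩ := h.2 j
    change IsExtendable H₁ H₂ k (L + 1 + c) _ _ at hab
    by_cases ha : ∀ i, i ≠ j → p i ≠ a
    · have hpn' := numValues_update_of_forall_ne ha
      by_cases hb : ∀ i, i ≠ j → q i ≠ b
      · have hqn' := numValues_update_of_forall_ne hb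
        exact IH _ _ (by omega) (hab.mono (by omega))
      · push Not at hb
        obtain ⟨i, hi, hib⟩ := hb
        have hqn' := numValues_update_of_eq hi hib
        refine ih (w := j) (by omega) (by omega) ?_ (isRepeated_update_self hi hib) hab
        have : IsBeyond H₁ p j a := hbey.resolve_right fun hb => (hb i hi).1 hib
        intro l hl
        rw [update_self, update_of_ne hl]
        exact this l hl
    · push Not at ha
      obtain ⟨i, hi, hia⟩ := ha
      have hpn' := numValues_update_of_eq hi hia
      have hb : IsBeyond H₂ q j b := hbey.resolve_left fun ha => (ha i hi).1 hia
      have hqn' := numValues_update_of_forall_ne fun l hl => (hb l hl).1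
      -- The old value `a` dominates `p w`, but `p w` has no arc to any other entry.
      have hwa : p w = a := by
        by_cases hiw : i = w
        · rw [← hiw, hia]
        · exact (hdom w hwj).resolve_right (hia ▸ (hp i hiw).2)
      obtain ⟨l, hlw, hl⟩ := hq
      have hlj : l ≠ j := by
        rintro rfl
        exact hqj ⟨w, hwj, hl.symm⟩
      refine false_of_isRepeated_of_isRepeated IH (j := w) (by omega)
        ⟨j, hwj.symm, ?_⟩ ⟨l, hlw, ?_⟩ (hab.mono (by omega))
      · rw [update_self, update_of_ne hwj, hwa]
      · rw [update_of_ne hlj, update_of_ne hwj, hl]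

theorem false_of_le_add (hk : k < Fintype.card α) (m : ℕ) {p : α → W₁} {q : α → W₂}
    (hm : 2 * k + 1 ≤ numValues p + numValues q + m)
    (h : IsExtendable H₁ H₂ k (m * (k + 3)) p q) : False := by
  induction m generalizing p q with
  | zero => have := h.numValues_le; omega
  | succ m ih =>
    have IH : ∀ (p : α → W₁) (q : α → W₂), (2 * k - m) + 1 ≤ numValues p + numValues q →
        ¬ IsExtendable H₁ H₂ k (m * (k + 3)) p q := fun p q hpq => ih (by omega)
    generalize hL : m * (k + 3) = L at IH
    -- Raising the total once costs at most one opening move, `k + 1` moves in `false_of_isBeyond`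
    -- and one final move.
    have hL' : (m + 1) * (k + 3) = L + 1 + (k + 1) + 1 := by rw [← hL]; ring
    rw [hL'] at h
    have hF : 2 * k - m ≤ numValues p + numValues q := by omega
    obtain ⟨j, hj⟩ := exists_isRepeated (h.numValues_le.1.trans_lt hk)
    by_cases hqj : IsRepeated q j
    · exact false_of_isRepeated_of_isRepeated IH hF hj hqj (h.mono (by omega))
    have hpn := hj.numValues_eq
    have hqn := numValues_eq_of_not_isRepeated hqj
    obtain ⟨a, b, hab, -, -, hbey⟩ := h.2 j
    by_cases ha : ∀ i, i ≠ j → p i ≠ a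
    · have hpn' := numValues_update_of_forall_ne ha
      by_cases hb : ∀ i, i ≠ j → q i ≠ b
      · have hqn' := numValues_update_of_forall_ne hb
        exact IH _ _ (by omega) (hab.mono (by omega))
      · push Not at hb
        obtain ⟨i, hi, hib⟩ := hb
        have hqn' := numValues_update_of_eq hi hib
        refine false_of_isBeyond hk IH (k + 1) (w := j) (by omega) (by omega) ?_
          (isRepeated_update_self hi hib) hab
        have : IsBeyond H₁ p j a := hbey.resolve_right fun hb => (hb i hi).1 hib
        intro l hl
        rw [update_self, update_of_ne hl]
        exact this l hl
    · push Not at ha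
      obtain ⟨i, hi, hia⟩ := ha
      have hpn' := numValues_update_of_eq hi hia
      have hb : IsBeyond H₂ q j b := hbey.resolve_left fun ha => (ha i hi).1 hia
      have hqn' := numValues_update_of_forall_ne fun l hl => (hb l hl).1
      refine false_of_isBeyond (F := 2 * k - m) hk
        (fun q p hqp h => IH p q (by omega) h.swap) (k + 1) (w := j) (by omega) (by omega) ?_
        (isRepeated_update_self hi hia) hab.swap
      intro l hl
      rw [update_self, update_of_ne hl]
      exact hb l hl

end IsExtendable

end Tuples

/-! ### The graph of words and its treewidth -/

section Construction

variable {α β : Type*}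

/-- Words of length at most `D`. -/
abbrev BoundedWord (α β : Type*) (D : ℕ) := {l : List (α × β) // l.length ≤ D}

namespace BoundedWord

variable {D : ℕ}

noncomputable instance [Finite α] [Finite β] : Fintype (BoundedWord α β D) :=
  (List.finite_length_le (α × β) D).fintype

/-- The word without its last letter. -/
def parent (x : BoundedWord α β D) : BoundedWord α β D := ⟨x.1.tail, by have := x.2; simp; omega⟩

/-- The word with one more letter. -/
def cons (x : BoundedWord α β D) (c : α × β) (h : x.1.length < D) : BoundedWord α β D :=
  ⟨c :: x.1, h⟩

theorem length_parent_lt {x : BoundedWord α β D} (h : x.1 ≠ []) :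
    x.parent.1.length < x.1.length := by
  have := List.length_pos_iff.2 h
  simp [parent]; omega

end BoundedWord

variable [DecidableEq α]

/-- Starting from a constant tuple, each letter `(j, i)` replaces the `j`-th entry by the word read
so far. -/
def wordTuple : List (α × β) → α → List (α × β)
  | [], _ => []
  | c :: l, j => if j = c.1 then c :: l else wordTuple l j

theorem length_wordTuple_le (l : List (α × β)) (j : α) : (wordTuple l j).length ≤ l.length := by
  induction l with
  | nil => simp [wordTuple]
  | cons c l ih =>
    rw [wordTuple]
    split_ifs
    · exact le_rfl
    · exact ih.trans (by simp)

namespace BoundedWord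

variable {D : ℕ}

/-- The tuple of vertices at a node. -/
def tuple (x : BoundedWord α β D) (j : α) : BoundedWord α β D :=
  ⟨wordTuple x.1 j, (length_wordTuple_le _ _).trans x.2⟩

theorem tuple_cons (x : BoundedWord α β D) (c : α × β) (h : x.1.length < D) :
    tuple (x.cons c h) = update (tuple x) c.1 (x.cons c h) := by
  ext1 j
  apply Subtype.ext
  by_cases hj : j = c.1
  · subst hj; simp [tuple, cons, wordTuple]
  · simp [tuple, cons, wordTuple, hj]

variable (α β D) in
/-- The graph in which the entries of every tuple form a clique. -/
def graph : SimpleGraph (BoundedWord α β D) where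
  Adj v w := v ≠ w ∧ ∃ x, v ∈ Set.range (tuple x) ∧ w ∈ Set.range (tuple x)
  symm := ⟨fun _ _ h => ⟨h.1.symm, h.2.imp fun _ h => h.symm⟩⟩
  loopless := ⟨fun _ h => h.1 rfl⟩

theorem exists_tuple_eq_self [Nonempty α] (v : BoundedWord α β D) : ∃ j, v.tuple j = v := by
  obtain ⟨_ | ⟨c, l⟩, hv⟩ := v
  · exact ⟨Classical.arbitrary α, rfl⟩
  · exact ⟨c.1, Subtype.ext (by simp [tuple, wordTuple])⟩

theorem tuple_parent_eq {x v : BoundedWord α β D} {j : α} (h : x.tuple j = v) (hxv : x ≠ v) :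
    x.1 ≠ [] ∧ x.parent.tuple j = v := by
  obtain ⟨_ | ⟨c, l⟩, hx⟩ := x
  · exact absurd h hxv
  · refine ⟨by simp, ?_⟩
    have hj : j ≠ c.1 := by
      rintro rfl
      exact hxv (h ▸ Subtype.ext (by simp [tuple, wordTuple]))
    rw [← h]
    exact Subtype.ext (by simp [tuple, wordTuple, parent, hj])

/-- The tree-decomposition of the graph by its tuples. -/
noncomputable def treeDecomposition [Fintype α] [Nonempty α] [Finite β] :
    (graph α β D).TreeDecomposition (SimpleGraph.parentGraph (parent (α := α) (β := β) (D := D)))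
    where
  isTree := SimpleGraph.parentGraph_isTree (rank := fun x => x.1.length) ⟨[], Nat.zero_le _⟩
    (fun x hx => length_parent_lt fun h => hx (Subtype.ext h)) rfl
  bag x := by classical exact univ.image x.tuple
  exists_bag_of_adj := by
    rintro v w ⟨-, x, hv, hw⟩
    exact ⟨x, by simpa using hv, by simpa using hw⟩
  connected v := by
    -- A vertex enters the bags at the node with the same word; below it, deleting the last letter
    -- keeps the vertex in the bag.
    refine SimpleGraph.induce_parentGraph_connected (rank := fun x => x.1.length) (t := v)
      (by simpa using exists_tuple_eq_self v) fun x hx hxv => ?_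
    obtain ⟨j, hj⟩ : ∃ j, x.tuple j = v := by simpa using hx
    obtain ⟨h1, h2⟩ := tuple_parent_eq hj hxv
    exact ⟨length_parent_lt h1, by simpa using ⟨j, h2⟩⟩

theorem exists_lt_numValues_tuple [Fintype α] [Nonempty α] [Nonempty β] (m : ℕ)
    (hm : m < Fintype.card α) (hD : m ≤ D) :
    ∃ x : BoundedWord α β D, x.1.length ≤ m ∧ m < numValues x.tuple := by
  induction m with
  | zero =>
    exact ⟨⟨[], Nat.zero_le _⟩, by simp, (Set.ncard_pos (Set.toFinite _)).2 (Set.range_nonempty _)⟩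
  | succ m ih =>
    obtain ⟨x, hx, hmx⟩ := ih (by omega) (by omega)
    by_cases hcard : numValues x.tuple < Fintype.card α
    · obtain ⟨j, hj⟩ := exists_isRepeated hcard
      let c : α × β := (j, Classical.arbitrary β)
      have hxD : x.1.length < D := by omega
      refine ⟨x.cons c hxD, by simp [cons]; omega, ?_⟩
      rw [tuple_cons, numValues_update_of_forall_ne]
      · rw [hj.numValues_eq] at hmx
        exact Nat.succ_lt_succ hmx
      · intro i _ hi
        have h1 := length_wordTuple_le x.1 i
        have h2 : wordTuple x.1 i = c :: x.1 := congrArg Subtype.val hi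
        rw [h2] at h1
        simp at h1
    · exact ⟨x, by omega, by omega⟩

theorem isClique_range_tuple (x : BoundedWord α β D) :
    (graph α β D).IsClique (Set.range x.tuple) :=
  fun _ hv _ hw hne => ⟨hne, x, hv, hw⟩

theorem treewidth_graph {α β : Type} [DecidableEq α] [Fintype α] [Nonempty α] [Finite β] [Nonempty β]
    (hD : Fintype.card α ≤ D + 1) :
    (graph α β D).treewidth = (Fintype.card α : ℤ) - 1 := by
  classical
  have hpos : 0 < Fintype.card α := Fintype.card_pos
  apply le_antisymm
  · refine (treeDecomposition (α := α) (β := β) (D := D)).treewidth_le.trans ?_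
    have : (univ.sup fun x : BoundedWord α β D => #(treeDecomposition.bag x)) ≤
        Fintype.card α :=
      Finset.sup_le fun x _ => card_image_le
    simp only [SimpleGraph.TreeDecomposition.width]
    omega
  · obtain ⟨x, -, hx⟩ := exists_lt_numValues_tuple (α := α) (β := β) (D := D)
      (Fintype.card α - 1) (by omega) (by omega)
    have h := SimpleGraph.card_le_treewidth_of_isClique (K := univ.image x.tuple)
      (by simpa using isClique_range_tuple x)
    have h2 : numValues x.tuple = #(univ.image x.tuple) := by
      rw [numValues, ← Set.ncard_coe_finset]; simp
    omega

end BoundedWord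

end Construction

/-! ### From a copy in the product to the game -/

section Embedding

variable {W W₁ W₂ α β : Type*} [Fintype α]

theorem Digraph.indegree_le_maxIndegree [Fintype W] (H : Digraph W) (v : W) :
    H.indegree v ≤ H.maxIndegree :=
  le_sup (f := fun v => H.indegree v) (Finset.mem_univ v)

theorem exists_finset_of_not_isBeyond [Fintype W] (H : Digraph W) {s : ℕ} (hs : H.maxIndegree ≤ s)
    (p : α → W) (j : α) : ∃ A : Finset W, #A ≤ Fintype.card α * (s + 1) ∧
      ∀ a, (∃ i, i ≠ j ∧ (p i = a ∨ H.Adj a (p i))) → a ∈ A := by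
  classical
  refine ⟨univ.biUnion fun i => insert (p i) (univ.filter fun u => H.Adj u (p i)), ?_, ?_⟩
  · refine card_biUnion_le_card_mul _ _ _ fun i _ => (card_insert_le _ _).trans ?_
    have h := (H.indegree_le_maxIndegree (p i)).trans hs
    rw [Digraph.indegree, ← coe_filter_univ, Set.ncard_coe_finset] at h
    omega
  · rintro a ⟨i, -, h⟩
    simp only [mem_biUnion, Finset.mem_univ, true_and, mem_insert, mem_filter]
    exact ⟨i, h.imp Eq.symm id⟩

theorem numValues_le_of_treewidth_le [Fintype W] {H : Digraph W} {k : ℕ}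
    (hH : H.underlying.treewidth ≤ (k : ℤ) - 1) {p : α → W}
    (hp : ∀ i j, p i = p j ∨ H.Adj (p i) (p j) ∨ H.Adj (p j) (p i)) : numValues p ≤ k := by
  classical
  have h := SimpleGraph.card_le_treewidth_of_isClique (G := H.underlying) (K := univ.image p) (by
    rintro v hv w hw hne
    obtain ⟨i, rfl⟩ : v ∈ Set.range p := by simpa using hv
    obtain ⟨j, rfl⟩ : w ∈ Set.range p := by simpa using hw
    exact (SimpleGraph.fromRel_adj ..).2 ⟨hne, (hp i j).resolve_left hne⟩)
  have h2 : numValues p = #(univ.image p) := by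
    rw [numValues, ← Set.ncard_coe_finset]; simp
  omega

variable [Fintype W₁] [Fintype W₂] {H₁ : Digraph W₁} {H₂ : Digraph W₂}

theorem exists_dominates_of_forall_adj [Fintype β] {s t : ℕ}
    (hs : H₁.maxIndegree ≤ s) (ht : H₂.maxIndegree ≤ t)
    (hβ : (Fintype.card α * (s + 1)) * (Fintype.card α * (t + 1)) < Fintype.card β)
    (p : α → W₁) (q : α → W₂) (j : α) (g : β → W₁ × W₂) (hg : Injective g)
    (hadj : ∀ b i, i ≠ j → (H₁.directedProd H₂).underlying.Adj (p i, q i) (g b)) :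
    ∃ b, Dominates H₁ p j (g b).1 ∧ Dominates H₂ q j (g b).2 ∧
      (IsBeyond H₁ p j (g b).1 ∨ IsBeyond H₂ q j (g b).2) := by
  classical
  obtain ⟨A₁, hA₁, h₁⟩ := exists_finset_of_not_isBeyond H₁ hs p j
  obtain ⟨A₂, hA₂, h₂⟩ := exists_finset_of_not_isBeyond H₂ ht q j
  -- An arc from the refill back to any entry would put both its coordinates in these sets, as would
  -- failing to be beyond in both.
  obtain ⟨b, hb⟩ : ∃ b, g b ∉ A₁ ×ˢ A₂ := by
    by_contra! h
    have := card_le_card_of_injOn (s := univ) g (fun b _ => h b) hg.injOn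
    rw [card_univ, card_product] at this
    exact absurd (this.trans (Nat.mul_le_mul hA₁ hA₂)) (not_le.2 hβ)
  have harc : ∀ i, i ≠ j → (H₁.directedProd H₂).Adj (p i, q i) (g b) := by
    intro i hi
    have h := hadj b i hi
    rw [Digraph.underlying, Digraph.toSimpleGraphInclusive, SimpleGraph.fromRel_adj] at h
    refine h.2.resolve_right fun h' => hb (mem_product.2 ?_)
    rcases h' with ⟨h1, h2⟩ | ⟨h2, h1⟩ | ⟨h1, h2⟩
    · exact ⟨h₁ _ ⟨i, hi, .inl h1.symm⟩, h₂ _ ⟨i, hi, .inr h2⟩⟩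
    · exact ⟨h₁ _ ⟨i, hi, .inr h1⟩, h₂ _ ⟨i, hi, .inl h2.symm⟩⟩
    · exact ⟨h₁ _ ⟨i, hi, .inr h1⟩, h₂ _ ⟨i, hi, .inr h2⟩⟩
  refine ⟨b, fun i hi => ?_, fun i hi => ?_, ?_⟩
  · rcases harc i hi with ⟨h1, h2⟩ | ⟨h2, h1⟩ | ⟨h1, h2⟩
    exacts [.inl h1, .inr h1, .inr h1]
  · rcases harc i hi with ⟨h1, h2⟩ | ⟨h2, h1⟩ | ⟨h1, h2⟩
    exacts [.inr h2, .inl h2, .inr h2]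
  · by_contra! h
    simp only [IsBeyond, not_forall, not_and_or, not_not] at h
    obtain ⟨⟨i, hi, h3⟩, ⟨i', hi', h4⟩⟩ := h
    exact hb (mem_product.2 ⟨h₁ _ ⟨i, hi, h3⟩, h₂ _ ⟨i', hi', h4⟩⟩)

variable [DecidableEq α]

theorem numValues_tuple_le {k D : ℕ} (hH₁ : H₁.underlying.treewidth ≤ (k : ℤ) - 1)
    (hH₂ : H₂.underlying.treewidth ≤ (k : ℤ) - 1)
    (f : (BoundedWord.graph α β D).Copy (H₁.directedProd H₂).underlying)
    (x : BoundedWord α β D) :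
    numValues (fun j => (f (x.tuple j)).1) ≤ k ∧ numValues (fun j => (f (x.tuple j)).2) ≤ k := by
  have hadj (i j : α) : f (x.tuple i) = f (x.tuple j) ∨
      (H₁.directedProd H₂).Adj (f (x.tuple i)) (f (x.tuple j)) ∨
      (H₁.directedProd H₂).Adj (f (x.tuple j)) (f (x.tuple i)) := by
    by_cases hij : x.tuple i = x.tuple j
    · exact .inl (by rw [hij])
    · exact .inr ((SimpleGraph.fromRel_adj ..).1 (f.toHom.map_adj
        (x.isClique_range_tuple ⟨i, rfl⟩ ⟨j, rfl⟩ hij))).2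
  refine ⟨numValues_le_of_treewidth_le hH₁ fun i j => ?_,
    numValues_le_of_treewidth_le hH₂ fun i j => ?_⟩
  all_goals
    rcases hadj i j with h | (⟨h1, h2⟩ | ⟨h2, h1⟩ | ⟨h1, h2⟩) | (⟨h1, h2⟩ | ⟨h2, h1⟩ | ⟨h1, h2⟩)
    all_goals simp_all

theorem isExtendable_of_copy [Fintype β] {s t k D : ℕ}
    (hs : H₁.maxIndegree ≤ s) (ht : H₂.maxIndegree ≤ t)
    (hβ : (Fintype.card α * (s + 1)) * (Fintype.card α * (t + 1)) < Fintype.card β)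
    (hH₁ : H₁.underlying.treewidth ≤ (k : ℤ) - 1) (hH₂ : H₂.underlying.treewidth ≤ (k : ℤ) - 1)
    (f : (BoundedWord.graph α β D).Copy (H₁.directedProd H₂).underlying) (n : ℕ)
    (x : BoundedWord α β D) (hx : x.1.length + n ≤ D) :
    IsExtendable H₁ H₂ k n (fun j => (f (x.tuple j)).1) (fun j => (f (x.tuple j)).2) := by
  induction n generalizing x with
  | zero => exact numValues_tuple_le hH₁ hH₂ f x
  | succ n ih =>
    refine ⟨numValues_tuple_le hH₁ hH₂ f x, fun j => ?_⟩
    have hxD : x.1.length < D := by omega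
    obtain ⟨b, hb⟩ := exists_dominates_of_forall_adj hs ht hβ (fun j => (f (x.tuple j)).1)
      (fun j => (f (x.tuple j)).2) j (fun b : β => f (x.cons (j, b) hxD))
      (fun b b' h => by
        have := congrArg Subtype.val (f.injective h)
        simpa [BoundedWord.cons] using this)
      (fun b i hi => by
        refine f.toHom.map_adj ⟨fun h => ?_, x.cons (j, b) hxD, ⟨i, ?_⟩, ⟨j, ?_⟩⟩
        · have h1 := length_wordTuple_le x.1 i
          have h2 : wordTuple x.1 i = (j, b) :: x.1 := congrArg Subtype.val h
          rw [h2] at h1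
          simp at h1
        · rw [BoundedWord.tuple_cons, update_of_ne hi]
        · rw [BoundedWord.tuple_cons, update_self])
    refine ⟨_, _, ?_, hb⟩
    have := ih (x.cons (j, b) hxD) (by simp [BoundedWord.cons]; omega)
    rw [BoundedWord.tuple_cons] at this
    convert this using 1
    all_goals
      ext1 i
      by_cases hi : i = j
      · subst hi; simp
      · simp [hi]

end Embedding

theorem theorem1p7 (s t k : ℕ) (hs : 1 ≤ s) (ht : 1 ≤ t) (hk : 1 ≤ k) :
    ∃ (V : Type) (_ : Fintype V) (G : SimpleGraph V), G.treewidth = (k : ℤ) ∧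
      ∀ (W₁ : Type*) (W₂ : Type*) [Fintype W₁] [Fintype W₂] (H₁ : Digraph W₁) (H₂ : Digraph W₂),
        H₁.maxIndegree ≤ s → H₂.maxIndegree ≤ t →
        H₁.underlying.treewidth ≤ (k : ℤ) - 1 → H₂.underlying.treewidth ≤ (k : ℤ) - 1 →
        ¬ G.IsContained (H₁.directedProd H₂).underlying := by
  let N := ((k + 1) * (s + 1)) * ((k + 1) * (t + 1)) + 1
  -- Enough depth for `2 * k + 1` increases of the total, at `k + 3` moves each.
  let D := (2 * k + 1) * (k + 3)
  refine ⟨BoundedWord (Fin (k + 1)) (Fin N) D, inferInstance, BoundedWord.graph _ _ _, ?_, ?_⟩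
  · rw [BoundedWord.treewidth_graph]
    · simp
    · simp only [Fintype.card_fin, D]
      nlinarith
  · rintro W₁ W₂ _ _ H₁ H₂ h₁ h₂ hH₁ hH₂ ⟨f⟩
    refine IsExtendable.false_of_le_add (by simp) (2 * k + 1) (by omega)
      (isExtendable_of_copy h₁ h₂ (by simp [N]) hH₁ hH₂ f ((2 * k + 1) * (k + 3))
        ⟨[], Nat.zero_le _⟩ (by simp [D]))
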